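/- **Theorem.** Let $\mathbb F_2^n$ be the $n$-dimensional vector space over $\mathbb F_2$. Every Boolean function $f\colon\mathbb F_2^n\to\mathbb F_2$ has a unique algebraic normal form $f(x)=\bigoplus_{S\subseteq\{1,\dots,n\}}c_S\prod_{i\in S}x_i$ with $c_S\in\mathbb F_2$; its degree is the largest $|S|$ with $c_S\neq0$. The function $f$ is *cubic* if its degree is $3$, and a cubic function is *homogeneous* if $|S|=3$ whenever $c_S\ne 0$. Put $D_af(x)=f(x\oplus a)\oplus f(x)$. The function $f$ is *bent* if for all $a\neq0$ and all $b\in\mathbb F_2$ the equation $D_af(x)=b$ has exactly $2^{n-1}$ solutions $x\in\mathbb F_2^n$. A cubic function $f$ is *without affine derivatives* if $D_af$ has degree $2$ for every $a\neq 0$. For $n=2m$, the *completed Maiorana–McFarland class* $\mathcal M^{\#}$ consists of all functions of the form $x\mapsto g(A(x))\oplus l(x)$, where $A$ is an invertible affine transformation of $\mathbb F_2^n$, $l$ is an affine function on $\mathbb F_2^n$, and $g(u,v)=\langle u,\pi(v)\rangle\oplus\varphi(v)$ for $u,v\in\mathbb F_2^m$, with some $\pi\colon\mathbb F_2^m\to\mathbb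 F_2^m$ and $\varphi\colon\mathbb F_2^m\to\mathbb F_2$ (such a $g$ is bent if and only if $\pi$ is a permutation). Then for even $n$ the following exist on $\mathbb F_2^n$: 1. cubic bent functions outside $\mathcal M^{\#}$, for all even $n\ge 10$; 2. cubic bent functions without affine derivatives outside $\mathcal M^{\#}$, for all even $n\ge 26$; 3. homogeneous cubic bent functions outside $\mathcal M^{\#}$, for all even $n\ge 26$; 4. homogeneous cubic bent functions without affine derivatives outside $\mathcal M^{\#}$, for all even $n\ge 50$. -/

import Mathlib

namespace CubicBent

/-- The vector space `𝔽₂ⁿ`. -/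
abbrev Vec (n : ℕ) : Type := Fin n → ZMod 2

/-- Boolean functions in `n` variables. -/
abbrev BoolFun (n : ℕ) : Type := Vec n → ZMod 2

/-- The 0/1 vector with support `S`. -/
def charVec {n : ℕ} (S : Finset (Fin n)) : Vec n := fun i => if i ∈ S then 1 else 0

/-- The coefficient of the monomial `∏ i ∈ S, x i` in the algebraic normal form of `f`, given by
Möbius inversion; `eq_sum_anfCoeff` and `anfCoeff_unique` show that these are exactly the
coefficients of the unique algebraic normal form. -/
def anfCoeff {n : ℕ} (f : BoolFun n) (S : Finset (Fin n)) : ZMod 2 :=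
  ∑ T ∈ S.powerset, f (charVec T)

/-- The monomial `∏ i ∈ S, x i` at a 0/1 vector. -/
theorem prod_charVec {n : ℕ} (S T : Finset (Fin n)) :
    ∏ i ∈ S, charVec T i = if S ⊆ T then 1 else 0 := by
  unfold charVec
  rw [Finset.prod_ite_zero]
  simp [Finset.subset_iff]

theorem exists_eq_charVec {n : ℕ} (x : Vec n) : ∃ T, x = charVec T := by
  refine ⟨Finset.univ.filter fun i => x i = 1, ?_⟩
  funext i
  have h : ∀ a : ZMod 2, a = if a = 1 then 1 else 0 := by decide
  simpa [charVec] using h (x i)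

/-- Möbius inversion on the Boolean lattice modulo 2. -/
theorem sum_powerset_sum_powerset {n : ℕ} (g : Finset (Fin n) → ZMod 2) (U : Finset (Fin n)) :
    ∑ S ∈ U.powerset, ∑ T ∈ S.powerset, g T = g U := by
  have h1 : ∑ S ∈ U.powerset, ∑ T ∈ S.powerset, g T
      = ∑ T ∈ U.powerset, ∑ S ∈ Finset.Icc T U, g T := by
    apply Finset.sum_comm'
    intro S T
    simp only [Finset.mem_powerset, Finset.mem_Icc]
    exact ⟨fun h => ⟨⟨h.2, h.1⟩, h.2.trans h.1⟩, fun h => ⟨h.1.2, h.1.1⟩⟩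
  rw [h1, Finset.sum_eq_single U]
  · simp
  · intro T hT hne
    have hTU := Finset.mem_powerset.1 hT
    have hlt : T.card < U.card := Finset.card_lt_card (hTU.ssubset_of_ne hne)
    rw [Finset.sum_const, Finset.card_Icc_finset hTU, nsmul_eq_mul]
    obtain ⟨k, hk⟩ : ∃ k, U.card - T.card = k + 1 := ⟨U.card - T.card - 1, by omega⟩
    have h2 : (2 : ZMod 2) = 0 := by decide
    rw [hk, pow_succ, Nat.cast_mul]
    simp [h2]
  · simp

/-- The algebraic normal form represents `f`. -/
theorem eq_sum_anfCoeff {n : ℕ} (f : BoolFun n) (x : Vec n) :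
    f x = ∑ S : Finset (Fin n), anfCoeff f S * ∏ i ∈ S, x i := by
  obtain ⟨U, rfl⟩ := exists_eq_charVec x
  simp only [prod_charVec, mul_ite, mul_one, mul_zero]
  rw [← Finset.sum_filter]
  have h : (Finset.univ.filter fun S : Finset (Fin n) => S ⊆ U) = U.powerset := by
    ext S; simp
  rw [h]
  exact (sum_powerset_sum_powerset (fun T => f (charVec T)) U).symm

/-- The algebraic normal form is unique. -/
theorem anfCoeff_unique {n : ℕ} (f : BoolFun n) (c : Finset (Fin n) → ZMod 2)
    (hc : ∀ x, f x = ∑ S : Finset (Fin n), c S * ∏ i ∈ S, x i) : c = anfCoeff f := by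
  funext U
  have h : ∀ T, f (charVec T) = ∑ S ∈ T.powerset, c S := by
    intro T
    rw [hc]
    simp only [prod_charVec, mul_ite, mul_one, mul_zero]
    rw [← Finset.sum_filter]
    congr 1
    ext S; simp
  unfold anfCoeff
  simp only [h]
  exact (sum_powerset_sum_powerset c U).symm

/-- The algebraic degree (`0` for the zero function). -/
def degree {n : ℕ} (f : BoolFun n) : ℕ :=
  (Finset.univ.filter fun S : Finset (Fin n) => anfCoeff f S ≠ 0).sup Finset.card

/-- A Boolean function of algebraic degree three. -/
def IsCubic {n : ℕ} (f : BoolFun n) : Prop := degree f = 3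

/-- All monomials of the algebraic normal form have degree `d`. -/
def IsHomogeneous {n : ℕ} (d : ℕ) (f : BoolFun n) : Prop :=
  ∀ S : Finset (Fin n), anfCoeff f S ≠ 0 → S.card = d

/-- The first-order derivative of `f` in direction `a`. -/
def deriv {n : ℕ} (a : Vec n) (f : BoolFun n) : BoolFun n := fun x => f (x + a) + f x

/-- For a cubic `f`: all derivatives in nonzero directions are quadratic. -/
def HasNoAffineDerivatives {n : ℕ} (f : BoolFun n) : Prop :=
  ∀ a : Vec n, a ≠ 0 → degree (deriv a f) = 2

/-- `f` is bent: all derivatives in nonzero directions are balanced. -/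
def IsBent {n : ℕ} (f : BoolFun n) : Prop :=
  ∀ a : Vec n, a ≠ 0 → ∀ b : ZMod 2,
    (Finset.univ.filter fun x : Vec n => deriv a f x = b).card = 2 ^ (n - 1)

/-- Equivalence of Boolean functions: `f' x = f (A x) + l x` with an invertible affine map `A`
and an affine function `l`. -/
def Equivalent {n : ℕ} (f f' : BoolFun n) : Prop :=
  ∃ (A : Vec n ≃ᵃ[ZMod 2] Vec n) (l : Vec n →ᵃ[ZMod 2] ZMod 2), ∀ x, f' x = f (A x) + l x

/-- The function `(x, y) ↦ ⟨x, π y⟩ + φ y` on `𝔽₂ʳ × 𝔽₂ˢ = 𝔽₂ʳ⁺ˢ`. -/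
def mmFun {r s : ℕ} (π : Vec s → Vec r) (φ : BoolFun s) : BoolFun (r + s) :=
  fun z => (fun i : Fin r => z (Fin.castAdd s i)) ⬝ᵥ π (fun j : Fin s => z (Fin.natAdd r j))
    + φ (fun j : Fin s => z (Fin.natAdd r j))

/-- The completed generalized Maiorana–McFarland class of functions on `𝔽₂ⁿ`, `n = r + s`:
the functions equivalent to some `mmFun π φ`, with arbitrary maps `π` and `φ`. -/
def completedMMrs (n r s : ℕ) : Set (BoolFun n) :=
  {f | ∃ (h : r + s = n) (π : Vec s → Vec r) (φ : BoolFun s),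
    Equivalent (fun x : Vec n => mmFun π φ (fun i => x (Fin.cast h i))) f}

/-- The completed Maiorana–McFarland class `𝓜^#` on `𝔽₂ⁿ`: the case `r = s = n / 2`.
(For a bent function in this class the map `π` is necessarily a permutation.) -/
def completedMM (n : ℕ) : Set (BoolFun n) :=
  {f | ∃ m : ℕ, f ∈ completedMMrs n m m}

end CubicBent

namespace CubicBent

/-! ### Iterated derivatives and the algebraic degree -/

/-! A function in the completed Maiorana–McFarland class has a subspace of dimension `n / 2` on
which all second derivatives vanish. The obstruction is the relaxed index: the largest dimension of
a subspace on which the second derivatives are merely constant. If `f` in `m` variables has relaxed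
index at most `r` with `2 * r < m`, and `g` is any bent function in new variables, then such a
subspace for the direct sum projects to a space of dimension at most `r` on the side of `f`. The
kernel of this projection has at most half the dimension on the side of `g`, by
`IsBent.two_mul_finrank_le`. So the total is too small (`directSum_notMem_completedMM`).

The seed is `bentTen`, two copies of `pencil` joined by a product of two coordinates. Each copy has
relaxed index at most 2 (`relaxedIndexLE_pencil`), and a quadratic term does not affect the bound,
so the index is at most 4, and 8 < 10.

The other properties pass to direct sums. Bentness is proved in the stronger form `StronglyBent`.
Degree and absence of affine derivatives are expressed by iterated derivatives, hence are invariant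
under linear maps. Homogeneity is arranged by a linear change of basis after which the function
vanishes at all vectors of weight below 3. Summands in 2, 6, 10 and 12 variables then fill all the
required dimensions. -/

theorem add_self_eq_zero (t : ZMod 2) : t + t = 0 := CharTwo.add_self_eq_zero t

theorem deriv_add {n : ℕ} (a : Vec n) (f g : BoolFun n) :
    deriv a (f + g) = deriv a f + deriv a g := by
  funext x; simp only [deriv, Pi.add_apply]; ring

@[simp] theorem deriv_zero_fun {n : ℕ} (a : Vec n) : deriv a (0 : BoolFun n) = 0 := by
  funext x; simp [deriv]

@[simp] theorem deriv_zero_dir {n : ℕ} (f : BoolFun n) : deriv 0 f = 0 := by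
  funext x; simp [deriv, add_self_eq_zero]

theorem deriv_comm {n : ℕ} (a b : Vec n) (f : BoolFun n) :
    deriv a (deriv b f) = deriv b (deriv a f) := by
  funext x; simp only [deriv, add_right_comm x a b]; ring

/-- All `k`-fold derivatives of `f` vanish. -/
def DerivVanish {n : ℕ} : ℕ → BoolFun n → Prop
  | 0, f => f = 0
  | k + 1, f => ∀ a, DerivVanish k (deriv a f)

namespace DerivVanish

theorem zero {n : ℕ} (k : ℕ) : DerivVanish k (0 : BoolFun n) := by
  induction k with
  | zero => rfl
  | succ k ih => intro a; simpa using ih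

theorem succ {n k : ℕ} {f : BoolFun n} (hf : DerivVanish k f) : DerivVanish (k + 1) f := by
  induction k generalizing f with
  | zero => rw [show f = 0 from hf]; exact zero _
  | succ k ih => exact fun a => ih (hf a)

theorem mono {n k l : ℕ} (hkl : k ≤ l) {f : BoolFun n} (hf : DerivVanish k f) :
    DerivVanish l f := by
  induction hkl with
  | refl => exact hf
  | step _ ih => exact ih.succ

theorem add {n k : ℕ} {f g : BoolFun n} (hf : DerivVanish k f) (hg : DerivVanish k g) :
    DerivVanish k (f + g) := by
  induction k generalizing f g with
  | zero => rw [show f = 0 from hf, show g = 0 from hg]; exact add_zero 0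
  | succ k ih => intro a; rw [deriv_add]; exact ih (hf a) (hg a)

theorem translate {n k : ℕ} {f : BoolFun n} (hf : DerivVanish k f) (c : Vec n) :
    DerivVanish k (fun x => f (x + c)) := by
  induction k generalizing f with
  | zero => rw [show f = 0 from hf]; rfl
  | succ k ih =>
    intro a
    have h := ih (hf a)
    convert h using 1
    funext x; simp only [deriv, add_right_comm x a c]

theorem const_mul {n k : ℕ} {f : BoolFun n} (hf : DerivVanish k f) (t : ZMod 2) :
    DerivVanish k (fun x => t * f x) := by
  induction k generalizing f with
  | zero => rw [show f = 0 from hf]; funext x; simp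
  | succ k ih =>
    intro a
    have h := ih (hf a)
    convert h using 1
    funext x; simp only [deriv]; ring

/-- Leibniz rule: `D_a (x_i f) = x_i D_a f + a_i f(x + a)`. Each coordinate factor costs one more
derivative, which bounds the degree of monomials. -/
theorem coord_mul {n k : ℕ} {f : BoolFun n} (hf : DerivVanish k f) (i : Fin n) :
    DerivVanish (k + 1) (fun x => x i * f x) := by
  induction k generalizing f with
  | zero =>
    rw [show f = 0 from hf]
    convert zero 1 using 1
    funext x; simp
  | succ k ih =>
    intro a
    have h := (ih (hf a)).add ((hf.translate a).const_mul (a i))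
    convert h using 1
    funext x
    simp only [deriv, Pi.add_apply]
    ring

theorem const {n : ℕ} (t : ZMod 2) : DerivVanish 1 (fun _ : Vec n => t) :=
  fun _ => funext fun _ => add_self_eq_zero t

theorem prod {n : ℕ} (S : Finset (Fin n)) :
    DerivVanish (S.card + 1) (fun x : Vec n => ∏ i ∈ S, x i) := by
  induction S using Finset.induction_on with
  | empty => simpa using const 1
  | insert a S ha ih =>
    rw [Finset.card_insert_of_notMem ha]
    simpa only [Finset.prod_insert ha] using ih.coord_mul a

theorem sum {n k : ℕ} {ι : Type*} (s : Finset ι) (F : ι → BoolFun n)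
    (h : ∀ i ∈ s, DerivVanish k (F i)) : DerivVanish k (fun x => ∑ i ∈ s, F i x) := by
  classical
  induction s using Finset.induction_on with
  | empty => exact zero k
  | insert a s ha ih =>
    simp only [Finset.sum_insert ha]
    exact (h a (Finset.mem_insert_self a s)).add
      (ih fun i hi => h i (Finset.mem_insert_of_mem hi))

end DerivVanish

theorem charVec_insert {n : ℕ} {a : Fin n} {T : Finset (Fin n)} (ha : a ∉ T) :
    charVec (insert a T) = charVec T + charVec {a} := by
  funext i
  by_cases h : i = a
  · subst h; simp [charVec, ha]
  · simp [charVec, h]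

theorem anfCoeff_insert {n : ℕ} (f : BoolFun n) {a : Fin n} {S : Finset (Fin n)} (ha : a ∉ S) :
    anfCoeff f (insert a S) = anfCoeff (deriv (charVec {a}) f) S := by
  unfold anfCoeff
  rw [Finset.sum_powerset_insert ha, add_comm, ← Finset.sum_add_distrib]
  refine Finset.sum_congr rfl fun T hT => ?_
  rw [charVec_insert fun h => ha (Finset.mem_powerset.1 hT h)]
  rfl

/-- Differentiating along a basis vector removes that variable from a monomial (`anfCoeff_insert`),
so the coefficient at `S` is also a coefficient of a `k`-fold derivative. -/
theorem DerivVanish.anfCoeff_eq_zero {n k : ℕ} {f : BoolFun n} (hf : DerivVanish k f)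
    {S : Finset (Fin n)} (hS : k ≤ S.card) : anfCoeff f S = 0 := by
  induction k generalizing f S with
  | zero => rw [show f = 0 from hf]; simp [anfCoeff]
  | succ k ih =>
    obtain ⟨a, ha⟩ := Finset.card_pos.1 (by omega : 0 < S.card)
    rw [← Finset.insert_erase ha, anfCoeff_insert f (Finset.notMem_erase a S)]
    exact ih (hf _) (by rw [Finset.card_erase_of_mem ha]; omega)

/-- The degree is at most `k` iff all `(k + 1)`-fold derivatives vanish. -/
theorem degree_le_iff {n k : ℕ} (f : BoolFun n) : degree f ≤ k ↔ DerivVanish (k + 1) f := by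
  constructor
  · intro h
    have hf : f = fun x => ∑ S : Finset (Fin n), anfCoeff f S * ∏ i ∈ S, x i :=
      funext (eq_sum_anfCoeff f)
    rw [hf]
    refine DerivVanish.sum _ _ fun S _ => ?_
    by_cases hS : anfCoeff f S = 0
    · convert DerivVanish.zero (k + 1) using 1
      funext x; simp [hS]
    · have hc : S.card ≤ k := (Finset.le_sup (f := Finset.card) (by simpa using hS)).trans h
      exact ((DerivVanish.prod S).mono (by omega)).const_mul _
  · intro h
    refine Finset.sup_le fun S hS => ?_
    by_contra hc
    exact (Finset.mem_filter.1 hS).2 (h.anfCoeff_eq_zero (by omega))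

theorem isCubic_of_derivVanish {n : ℕ} {f : BoolFun n} (h4 : DerivVanish 4 f)
    (h3 : ¬ DerivVanish 3 f) : IsCubic f := by
  have h1 := (degree_le_iff (k := 3) f).2 h4
  have h2 := mt (degree_le_iff (k := 2) f).1 h3
  unfold IsCubic; omega

/-- No derivative in a nonzero direction has all its second derivatives equal to zero. -/
def DerivsNotAffine {n : ℕ} (f : BoolFun n) : Prop :=
  ∀ a : Vec n, a ≠ 0 → ¬ DerivVanish 2 (deriv a f)

theorem hasNoAffineDerivatives_of_derivVanish {n : ℕ} {f : BoolFun n} (h4 : DerivVanish 4 f)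
    (h : DerivsNotAffine f) : HasNoAffineDerivatives f := by
  intro a ha
  have h1 := (degree_le_iff (k := 2) _).2 (h4 a)
  have h2 := mt (degree_le_iff (k := 1) _).1 (h a ha)
  omega

/-- `f` vanishes at all vectors of weight less than three. -/
def VanishLowWeight {n : ℕ} (f : BoolFun n) : Prop :=
  ∀ S : Finset (Fin n), S.card < 3 → f (charVec S) = 0

/-- By Möbius inversion a coefficient with `|S| < 3` is a sum of values at vectors of weight below
3; those with `|S| > 3` are killed by the degree bound. -/
theorem isHomogeneous_of_vanishLowWeight {n : ℕ} {f : BoolFun n} (h4 : DerivVanish 4 f)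
    (h : VanishLowWeight f) : IsHomogeneous 3 f := by
  intro S hS
  by_contra hne
  rcases lt_or_gt_of_ne hne with hlt | hgt
  · refine hS (Finset.sum_eq_zero fun T hT => h T ?_)
    exact (Finset.card_le_card (Finset.mem_powerset.1 hT)).trans_lt hlt
  · exact hS (h4.anfCoeff_eq_zero hgt)

/-! ### A criterion for bentness -/

/-- Every derivative in a nonzero direction has itself a derivative that is constantly one. -/
def StronglyBent {n : ℕ} (f : BoolFun n) : Prop :=
  ∀ a : Vec n, a ≠ 0 → ∃ c, deriv c (deriv a f) = 1

theorem StronglyBent.isBent {n : ℕ} {f : BoolFun n} (hf : StronglyBent f) : IsBent f := by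
  intro a ha b
  obtain ⟨c, hc⟩ := hf a ha
  have hc' : ∀ x, deriv a f (x + c) = deriv a f x + 1 := fun x => by
    have h : deriv a f (x + c) + deriv a f x = 1 := congrFun hc x
    rw [← h, add_comm (deriv a f (x + c)), ← add_assoc, add_self_eq_zero, zero_add]
  have hinv : ∀ x : Vec n, x + c + c = x := fun x => by
    rw [add_assoc, show c + c = 0 from funext fun i => add_self_eq_zero _, add_zero]
  -- Translation by `c` flips the value of the derivative, so it exchanges the two fibres.
  have h1 : (Finset.univ.filter fun x : Vec n => deriv a f x = b).card
      = (Finset.univ.filter fun x : Vec n => ¬ deriv a f x = b).card := by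
    have h2 : ∀ s t : ZMod 2, ¬ s = t ↔ s + 1 = t := by decide
    refine Finset.card_bij' (fun x _ => x + c) (fun x _ => x + c) ?_ ?_ ?_ ?_
    · intro x hx
      simp only [Finset.mem_filter, Finset.mem_univ, true_and, h2, hc'] at hx ⊢
      rw [add_assoc, add_self_eq_zero, add_zero, hx]
    · intro x hx
      simpa only [Finset.mem_filter, Finset.mem_univ, true_and, h2, hc'] using hx
    · intro x _; exact hinv x
    · intro x _; exact hinv x
  have h3 := Finset.card_filter_add_card_filter_not (s := (Finset.univ : Finset (Vec n)))
    (fun x => deriv a f x = b)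
  rw [← h1, Finset.card_univ, Fintype.card_fun, ZMod.card, Fintype.card_fin] at h3
  have hn : n ≠ 0 := by
    rintro rfl; exact ha (Subsingleton.elim _ _)
  have h4 : 2 ^ n = 2 ^ (n - 1) * 2 := by
    rw [← pow_succ, Nat.sub_add_cancel (Nat.one_le_iff_ne_zero.2 hn)]
  omega

open Module

/-! ### Direct sums -/

/-- The first block of coordinates. -/
def fstBlock (m n : ℕ) : Vec (m + n) →ₗ[ZMod 2] Vec m :=
  LinearMap.funLeft (ZMod 2) (ZMod 2) (Fin.castAdd n)

/-- The second block of coordinates. -/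
def sndBlock (m n : ℕ) : Vec (m + n) →ₗ[ZMod 2] Vec n :=
  LinearMap.funLeft (ZMod 2) (ZMod 2) (Fin.natAdd m)

@[simp] theorem fstBlock_append {m n : ℕ} (a : Vec m) (b : Vec n) :
    fstBlock m n (Fin.append a b) = a := by
  funext i; simp [fstBlock, LinearMap.funLeft_apply]

@[simp] theorem sndBlock_append {m n : ℕ} (a : Vec m) (b : Vec n) :
    sndBlock m n (Fin.append a b) = b := by
  funext i; simp [sndBlock, LinearMap.funLeft_apply]

theorem eq_of_blocks_eq {m n : ℕ} {a b : Vec (m + n)} (h1 : fstBlock m n a = fstBlock m n b)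
    (h2 : sndBlock m n a = sndBlock m n b) : a = b := by
  funext i
  refine Fin.addCases (fun j => ?_) (fun j => ?_) i
  · exact congrFun h1 j
  · exact congrFun h2 j

theorem blocks_ne_zero {m n : ℕ} {a : Vec (m + n)} (ha : a ≠ 0) :
    fstBlock m n a ≠ 0 ∨ sndBlock m n a ≠ 0 := by
  by_contra! h
  exact ha (eq_of_blocks_eq (by rw [h.1, map_zero]) (by rw [h.2, map_zero]))

/-- The direct sum `(x, y) ↦ f x + g y`. -/
def directSum {m n : ℕ} (f : BoolFun m) (g : BoolFun n) : BoolFun (m + n) :=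
  fun z => f (fstBlock m n z) + g (sndBlock m n z)

theorem deriv_directSum {m n : ℕ} (a : Vec (m + n)) (f : BoolFun m) (g : BoolFun n) :
    deriv a (directSum f g)
      = directSum (deriv (fstBlock m n a) f) (deriv (sndBlock m n a) g) := by
  funext z; simp only [deriv, directSum, map_add]; ring

theorem directSum_zero_zero {m n : ℕ} : directSum (0 : BoolFun m) (0 : BoolFun n) = 0 := by
  funext z; simp [directSum]

theorem DerivVanish.directSum {m n k : ℕ} {f : BoolFun m} {g : BoolFun n} (hf : DerivVanish k f)
    (hg : DerivVanish k g) : DerivVanish k (directSum f g) := by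
  induction k generalizing f g with
  | zero => rw [show f = 0 from hf, show g = 0 from hg]; exact directSum_zero_zero
  | succ k ih => intro a; rw [deriv_directSum]; exact ih (hf _) (hg _)

theorem DerivVanish.of_directSum_zero_right {m n k : ℕ} {f : BoolFun m}
    (h : DerivVanish k (CubicBent.directSum f (0 : BoolFun n))) : DerivVanish k f := by
  induction k generalizing f with
  | zero =>
    funext x
    simpa [CubicBent.directSum] using congrFun h (Fin.append x 0)
  | succ k ih =>
    intro a
    have := h (Fin.append a 0)
    rw [deriv_directSum, fstBlock_append, sndBlock_append, deriv_zero_dir] at this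
    exact ih this

theorem DerivVanish.of_directSum_zero_left {m n k : ℕ} {g : BoolFun n}
    (h : DerivVanish k (CubicBent.directSum (0 : BoolFun m) g)) : DerivVanish k g := by
  induction k generalizing g with
  | zero =>
    funext x
    simpa [CubicBent.directSum] using congrFun h (Fin.append 0 x)
  | succ k ih =>
    intro a
    have := h (Fin.append 0 a)
    rw [deriv_directSum, fstBlock_append, sndBlock_append, deriv_zero_dir] at this
    exact ih this

/-- A derivative in a direction `(a, 0)` eliminates `g`. At least one derivative is needed: a
vanishing direct sum only forces `f` to be constant, hence `k + 1`. -/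
theorem DerivVanish.directSum_left {m n k : ℕ} {f : BoolFun m} {g : BoolFun n}
    (h : DerivVanish (k + 1) (CubicBent.directSum f g)) : DerivVanish (k + 1) f := by
  intro a
  have := h (Fin.append a 0)
  rw [deriv_directSum, fstBlock_append, sndBlock_append, deriv_zero_dir] at this
  exact this.of_directSum_zero_right

theorem DerivVanish.directSum_right {m n k : ℕ} {f : BoolFun m} {g : BoolFun n}
    (h : DerivVanish (k + 1) (CubicBent.directSum f g)) : DerivVanish (k + 1) g := by
  intro a
  have := h (Fin.append 0 a)
  rw [deriv_directSum, fstBlock_append, sndBlock_append, deriv_zero_dir] at this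
  exact this.of_directSum_zero_left

theorem StronglyBent.directSum {m n : ℕ} {f : BoolFun m} {g : BoolFun n} (hf : StronglyBent f)
    (hg : StronglyBent g) : StronglyBent (directSum f g) := by
  intro a ha
  rcases blocks_ne_zero ha with h | h
  · obtain ⟨c, hc⟩ := hf _ h
    refine ⟨Fin.append c 0, ?_⟩
    rw [deriv_directSum, deriv_directSum, fstBlock_append, sndBlock_append, hc, deriv_zero_dir]
    funext z; simp [CubicBent.directSum]
  · obtain ⟨c, hc⟩ := hg _ h
    refine ⟨Fin.append 0 c, ?_⟩
    rw [deriv_directSum, deriv_directSum, fstBlock_append, sndBlock_append, hc, deriv_zero_dir]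
    funext z; simp [CubicBent.directSum]

theorem DerivsNotAffine.directSum {m n : ℕ} {f : BoolFun m} {g : BoolFun n}
    (hf : DerivsNotAffine f) (hg : DerivsNotAffine g) : DerivsNotAffine (directSum f g) := by
  intro a ha h
  rw [deriv_directSum] at h
  rcases blocks_ne_zero ha with h' | h'
  · exact hf _ h' h.directSum_left
  · exact hg _ h' h.directSum_right

theorem VanishLowWeight.directSum {m n : ℕ} {f : BoolFun m} {g : BoolFun n}
    (hf : VanishLowWeight f) (hg : VanishLowWeight g) : VanishLowWeight (directSum f g) := by
  intro S hS
  have h1 : fstBlock m n (charVec S)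
      = charVec (S.preimage (Fin.castAdd n) (Fin.castAdd_injective m n).injOn) := by
    funext i; simp [fstBlock, LinearMap.funLeft_apply, charVec]
  have h2 : sndBlock m n (charVec S)
      = charVec (S.preimage (Fin.natAdd m) (Fin.natAdd_injective n m).injOn) := by
    funext i; simp [sndBlock, LinearMap.funLeft_apply, charVec]
  have hc1 : (S.preimage (Fin.castAdd n) (Fin.castAdd_injective m n).injOn).card ≤ S.card :=
    Finset.card_le_card_of_injOn (Fin.castAdd n) (fun x hx => by simpa using hx)
      (Fin.castAdd_injective m n).injOn
  have hc2 : (S.preimage (Fin.natAdd m) (Fin.natAdd_injective n m).injOn).card ≤ S.card :=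
    Finset.card_le_card_of_injOn (Fin.natAdd m) (fun x hx => by simpa using hx)
      (Fin.natAdd_injective n m).injOn
  unfold CubicBent.directSum
  rw [h1, h2, hf _ (hc1.trans_lt hS), hg _ (hc2.trans_lt hS), add_zero]

/-! ### Linear changes of coordinates -/

theorem deriv_comp {n : ℕ} (A : Vec n ≃ₗ[ZMod 2] Vec n) (a : Vec n) (f : BoolFun n) :
    deriv a (f ∘ A) = deriv (A a) f ∘ A := by
  funext x; simp [deriv]

theorem DerivVanish.comp {n k : ℕ} {f : BoolFun n} (hf : DerivVanish k f)
    (A : Vec n ≃ₗ[ZMod 2] Vec n) : DerivVanish k (f ∘ A) := by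
  induction k generalizing f with
  | zero => rw [show f = 0 from hf]; rfl
  | succ k ih => intro a; rw [deriv_comp]; exact ih (hf _)

theorem DerivVanish.of_comp {n k : ℕ} {f : BoolFun n} {A : Vec n ≃ₗ[ZMod 2] Vec n}
    (h : DerivVanish k (f ∘ A)) : DerivVanish k f := by
  have := h.comp A.symm
  rwa [Function.comp_assoc, show (A : Vec n → Vec n) ∘ A.symm = id from
    funext A.apply_symm_apply, Function.comp_id] at this

theorem StronglyBent.comp {n : ℕ} {f : BoolFun n} (hf : StronglyBent f)
    (A : Vec n ≃ₗ[ZMod 2] Vec n) : StronglyBent (f ∘ A) := by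
  intro a ha
  obtain ⟨c, hc⟩ := hf (A a) (by simpa using ha)
  refine ⟨A.symm c, ?_⟩
  rw [deriv_comp, deriv_comp, A.apply_symm_apply, hc]
  rfl

theorem DerivsNotAffine.comp {n : ℕ} {f : BoolFun n} (hf : DerivsNotAffine f)
    (A : Vec n ≃ₗ[ZMod 2] Vec n) : DerivsNotAffine (f ∘ A) := by
  intro a ha h
  rw [deriv_comp] at h
  exact hf (A a) (by simpa using ha) h.of_comp

/-! ### The relaxed index -/

/-- Every subspace on which all second derivatives of `f` are constant has dimension at
most `r`. -/
def RelaxedIndexLE {n : ℕ} (f : BoolFun n) (r : ℕ) : Prop :=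
  ∀ U : Submodule (ZMod 2) (Vec n),
    (∀ a ∈ U, ∀ b ∈ U, DerivVanish 1 (deriv a (deriv b f))) → finrank (ZMod 2) U ≤ r

theorem RelaxedIndexLE.comp {n r : ℕ} {f : BoolFun n} (hf : RelaxedIndexLE f r)
    (A : Vec n ≃ₗ[ZMod 2] Vec n) : RelaxedIndexLE (f ∘ A) r := by
  intro U hU
  rw [← LinearEquiv.finrank_map_eq A U]
  refine hf _ ?_
  rintro _ ⟨a, ha, rfl⟩ _ ⟨b, hb, rfl⟩
  have := hU a ha b hb
  rw [deriv_comp, deriv_comp] at this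
  exact this.of_comp

/-- The vectors of `U` with zero first block, as vectors of the second block. -/
def sndKernel {m n : ℕ} (U : Submodule (ZMod 2) (Vec (m + n))) : Submodule (ZMod 2) (Vec n) :=
  (U ⊓ LinearMap.ker (fstBlock m n)).map (sndBlock m n)

theorem mem_sndKernel {m n : ℕ} {U : Submodule (ZMod 2) (Vec (m + n))} {v : Vec n}
    (hv : v ∈ sndKernel U) : ∃ u ∈ U, fstBlock m n u = 0 ∧ sndBlock m n u = v := by
  obtain ⟨u, ⟨hu, hk⟩, rfl⟩ := hv
  exact ⟨u, hu, hk, rfl⟩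

/-- Rank–nullity for the first projection restricted to `U`; its kernel embeds into the second
block. -/
theorem finrank_le_blocks {m n : ℕ} (U : Submodule (ZMod 2) (Vec (m + n))) :
    finrank (ZMod 2) U
      ≤ finrank (ZMod 2) (U.map (fstBlock m n)) + finrank (ZMod 2) (sndKernel U) := by
  have h := LinearMap.finrank_range_add_finrank_ker ((fstBlock m n).domRestrict U)
  rw [LinearMap.range_domRestrict] at h
  rw [← h]
  refine Nat.add_le_add_left ?_ _
  let φ : LinearMap.ker ((fstBlock m n).domRestrict U) →ₗ[ZMod 2] sndKernel U :=
    LinearMap.codRestrict _ ((sndBlock m n) ∘ₗ U.subtype ∘ₗ Submodule.subtype _)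
      fun u => ⟨u.1.1, ⟨u.1.2, u.2⟩, rfl⟩
  refine LinearMap.finrank_le_finrank_of_injective (f := φ) ?_
  intro u v huv
  have h2 : sndBlock m n u.1.1 = sndBlock m n v.1.1 := congrArg Subtype.val huv
  have hu : fstBlock m n u.1.1 = 0 := u.2
  have hv : fstBlock m n v.1.1 = 0 := v.2
  exact Subtype.ext (Subtype.ext (eq_of_blocks_eq (hu.trans hv.symm) h2))

theorem RelaxedIndexLE.directSum {m n r s : ℕ} {f : BoolFun m} {g : BoolFun n}
    (hf : RelaxedIndexLE f r) (hg : RelaxedIndexLE g s) :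
    RelaxedIndexLE (directSum f g) (r + s) := by
  intro U hU
  refine (finrank_le_blocks U).trans (add_le_add (hf _ ?_) (hg _ ?_))
  · rintro _ ⟨a, ha, rfl⟩ _ ⟨b, hb, rfl⟩
    have := hU a ha b hb
    rw [deriv_directSum, deriv_directSum] at this
    exact this.directSum_left
  · intro a ha b hb
    obtain ⟨u, hu, -, rfl⟩ := mem_sndKernel ha
    obtain ⟨v, hv, -, rfl⟩ := mem_sndKernel hb
    have := hU u hu v hv
    rw [deriv_directSum, deriv_directSum] at this
    exact this.directSum_right

/-- Second derivatives of `q` are constant, so adding `q` does not change which second derivatives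
are constant. -/
theorem RelaxedIndexLE.add_quadratic {n r : ℕ} {f q : BoolFun n} (hf : RelaxedIndexLE f r)
    (hq : DerivVanish 3 q) : RelaxedIndexLE (f + q) r := by
  intro U hU
  refine hf U fun a ha b hb => ?_
  have h := (hU a ha b hb).add (hq b a)
  rw [deriv_add, deriv_add, add_assoc] at h
  rwa [show deriv a (deriv b q) + deriv a (deriv b q) = 0 from
    funext fun x => add_self_eq_zero _, add_zero] at h

/-! ### Subspaces on which all second derivatives vanish -/

/-- The character of `ZMod 2` with values `±1`. -/
def sign (t : ZMod 2) : ℤ := if t = 0 then 1 else -1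

theorem sign_add_one (t : ZMod 2) : sign (t + 1) = - sign t := by
  revert t; decide

theorem IsBent.sum_sign_deriv {n : ℕ} {f : BoolFun n} (hf : IsBent f) {a : Vec n} (ha : a ≠ 0) :
    ∑ x, sign (deriv a f x) = 0 := by
  have h : ∀ t : ZMod 2, sign t = (if t = 0 then 1 else 0) - (if t = 1 then 1 else 0) := by
    decide
  simp only [h, Finset.sum_sub_distrib, Finset.sum_boole]
  rw [hf a ha 0, hf a ha 1, sub_self]

/-- Double counting of the signs of `D_a f(x)` over `a ∈ K` and all `x`. Bentness leaves only `a =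
0`, giving `2 ^ n`. For fixed `x` the map `a ↦ D_a f(x)` is additive on `K`, so the sum over `a` is
`|K|` on the common zero set `Z` and 0 elsewhere. Thus `|Z| |K| = 2 ^ n`; as `Z` is nonempty and
`K`-invariant, `|K| ≤ |Z|`. -/
theorem IsBent.two_mul_finrank_le {n : ℕ} {f : BoolFun n} (hf : IsBent f)
    (K : Submodule (ZMod 2) (Vec n)) (hK : ∀ a ∈ K, ∀ b ∈ K, deriv a (deriv b f) = 0) :
    2 * finrank (ZMod 2) K ≤ n := by
  classical
  have hzero : ∀ a ∈ K, ∀ b ∈ K, ∀ x, deriv b f (x + a) = deriv b f x := fun a ha b hb x => by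
    have h : deriv b f (x + a) + deriv b f x = 0 := congrFun (hK a ha b hb) x
    exact CharTwo.add_eq_zero.1 h
  have hadd : ∀ a ∈ K, ∀ b ∈ K, ∀ x, deriv (a + b) f x = deriv a f x + deriv b f x :=
    fun a ha b hb x => by
      rw [← hzero a ha b hb x]
      simp only [deriv, add_assoc]
      linear_combination -(add_self_eq_zero (f (x + a)))
  let Z : Finset (Vec n) := Finset.univ.filter fun x => ∀ a ∈ K, deriv a f x = 0
  have hin : ∀ x, ∑ a : K, sign (deriv a.1 f x) = if x ∈ Z then (Fintype.card K : ℤ) else 0 := by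
    intro x
    split_ifs with hx
    · have hx' : ∀ a ∈ K, deriv a f x = 0 := by simpa [Z] using hx
      simp [hx', sign]
    · obtain ⟨b, hb, hbx⟩ : ∃ b ∈ K, deriv b f x ≠ 0 := by simpa [Z] using hx
      have hb1 : deriv b f x = 1 := by
        revert hbx; generalize deriv b f x = t; revert t; decide
      have h := Equiv.sum_comp (Equiv.addRight (⟨b, hb⟩ : K))
        (fun a : K => sign (deriv a.1 f x))
      have h' : ∀ a : K, sign (deriv (Equiv.addRight (⟨b, hb⟩ : K) a).1 f x)
          = - sign (deriv a.1 f x) := fun a => by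
        rw [← sign_add_one, ← hb1, ← hadd a.1 a.2 b hb x]; rfl
      simp only [h', Finset.sum_neg_distrib] at h
      omega
  have htot : ∑ x, ∑ a : K, sign (deriv a.1 f x) = 2 ^ n := by
    rw [Finset.sum_comm, Finset.sum_eq_single (0 : K)]
    · simp [sign]
    · intro a _ ha
      exact hf.sum_sign_deriv fun h => ha (Subtype.ext h)
    · simp
  simp only [hin, Finset.sum_ite_mem, Finset.univ_inter, Finset.sum_const, nsmul_eq_mul] at htot
  have htot' : Z.card * Fintype.card K = 2 ^ n := by exact_mod_cast htot
  have hne : Z.Nonempty := by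
    rw [Finset.nonempty_iff_ne_empty]
    intro h
    rw [h, Finset.card_empty, zero_mul] at htot'
    exact absurd htot'.symm (by positivity)
  obtain ⟨x, hx⟩ := hne
  have hx' : ∀ a ∈ K, deriv a f x = 0 := by simpa [Z] using hx
  have hle : Fintype.card K ≤ Z.card := by
    rw [← Finset.card_univ]
    refine Finset.card_le_card_of_injOn (fun a : K => x + a.1) ?_ ?_
    · intro a _
      simp only [Z, Finset.coe_filter, Finset.mem_univ, true_and, Set.mem_ofPred_eq]
      intro b hb
      rw [hzero a.1 a.2 b hb, hx' b hb]
    · intro a _ b _ hab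
      exact Subtype.ext (add_left_cancel hab)
  have hcard : Fintype.card K = 2 ^ finrank (ZMod 2) K := by
    rw [Module.card_eq_pow_finrank (K := ZMod 2), ZMod.card]
  have h2 : 2 ^ (2 * finrank (ZMod 2) K) ≤ 2 ^ n := by
    rw [← htot', two_mul, pow_add, ← hcard]
    exact Nat.mul_le_mul_right _ hle
  exact (Nat.pow_le_pow_iff_right (by norm_num)).1 h2

theorem finrank_ker_sndBlock (m n : ℕ) :
    finrank (ZMod 2) (LinearMap.ker (sndBlock m n)) = m := by
  have h := LinearMap.finrank_range_add_finrank_ker (sndBlock m n)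
  rw [LinearMap.range_eq_top.2 fun v => ⟨Fin.append 0 v, sndBlock_append 0 v⟩, finrank_top] at h
  simp only [finrank_fintype_fun_eq_card, Fintype.card_fin] at h
  omega

/-- For fixed `v` the function `⟨u, π v⟩ + φ v` is affine in `u`, so the space `v = 0`, pulled back
by the linear part of `A`, works. -/
theorem exists_subspace_of_mem_completedMM {n : ℕ} {f : BoolFun n} (hf : f ∈ completedMM n) :
    ∃ U : Submodule (ZMod 2) (Vec n), 2 * finrank (ZMod 2) U = n ∧
      ∀ a ∈ U, ∀ b ∈ U, deriv a (deriv b f) = 0 := by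
  obtain ⟨m, h, π, φ, A, l, hA⟩ := hf
  subst h
  refine ⟨(LinearMap.ker (sndBlock m m)).map
    (A.linear.symm : Vec (m + m) →ₗ[ZMod 2] Vec (m + m)), ?_, ?_⟩
  · rw [LinearEquiv.finrank_map_eq A.linear.symm, finrank_ker_sndBlock, two_mul]
  rintro _ ⟨a, ha, rfl⟩ _ ⟨b, hb, rfl⟩
  have hmm : ∀ z, mmFun π φ z
      = fstBlock m m z ⬝ᵥ π (sndBlock m m z) + φ (sndBlock m m z) := fun z => rfl
  have hA' : ∀ x c, A (x + A.linear.symm c) = A x + c := fun x c => by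
    have := A.map_vadd x (A.linear.symm c)
    rw [LinearEquiv.apply_symm_apply, vadd_eq_add, vadd_eq_add] at this
    rw [add_comm x, this]
    exact add_comm _ _
  have hl : ∀ x c, l (x + c) = l x + l.linear c := fun x c => by
    have := l.map_vadd x c
    rw [vadd_eq_add, vadd_eq_add] at this
    rw [add_comm x, this, add_comm]
  have ha0 : sndBlock m m a = 0 := ha
  have hb0 : sndBlock m m b = 0 := hb
  have h2 : (2 : ZMod 2) = 0 := by decide
  have h4 : (4 : ZMod 2) = 0 := by decide
  funext x
  simp only [deriv, hA, Fin.cast_eq_self, LinearEquiv.coe_coe, hA', hl, hmm, map_add, ha0, hb0,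
    add_zero, add_dotProduct, Pi.zero_apply]
  ring_nf
  simp [h2, h4]

/-- A function of small relaxed index stays outside the completed Maiorana–McFarland class after
adding any bent function in new variables. -/
theorem directSum_notMem_completedMM {m n r : ℕ} {f : BoolFun m} {g : BoolFun n}
    (hf : RelaxedIndexLE f r) (hr : 2 * r < m) (hg : IsBent g) :
    directSum f g ∉ completedMM (m + n) := by
  intro h
  obtain ⟨U, hU, hUf⟩ := exists_subspace_of_mem_completedMM h
  simp only [deriv_directSum] at hUf
  have h1 : finrank (ZMod 2) (U.map (fstBlock m n)) ≤ r := by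
    refine hf _ ?_
    rintro _ ⟨a, ha, rfl⟩ _ ⟨b, hb, rfl⟩
    have h0 : DerivVanish 0 (directSum (deriv (fstBlock m n a) (deriv (fstBlock m n b) f))
      (deriv (sndBlock m n a) (deriv (sndBlock m n b) g))) := hUf a ha b hb
    -- A vanishing sum of functions of separate variables makes each summand constant, which is why
    -- the relaxed index is the right notion for `f`.
    exact h0.succ.directSum_left
  have h2 : 2 * finrank (ZMod 2) (sndKernel U) ≤ n := by
    refine hg.two_mul_finrank_le _ fun a ha b hb => ?_
    obtain ⟨u, hu, hu0, rfl⟩ := mem_sndKernel ha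
    obtain ⟨v, hv, hv0, rfl⟩ := mem_sndKernel hb
    have h0 := hUf u hu v hv
    rw [hu0, deriv_zero_dir] at h0
    exact DerivVanish.of_directSum_zero_left (k := 0) h0
  have h3 := finrank_le_blocks U
  omega

/-! ### Small quadratic and cubic functions -/

theorem DerivVanish.coord_mul_coord {n : ℕ} (i j : Fin n) :
    DerivVanish 3 (fun x : Vec n => x i * x j) := by
  simpa using ((const (n := n) 1).coord_mul j).coord_mul i

theorem DerivVanish.coord_mul_coord_mul_coord {n : ℕ} (i j k : Fin n) :
    DerivVanish 4 (fun x : Vec n => x i * (x j * x k)) :=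
  (coord_mul_coord j k).coord_mul i

/-- The quadratic bent function in two variables. -/
def hyperbolic : BoolFun 2 := fun x => x 0 * x 1

theorem deriv_deriv_hyperbolic (a c x : Vec 2) :
    deriv c (deriv a hyperbolic) x = a 0 * c 1 + a 1 * c 0 := by
  simp only [deriv, hyperbolic, Pi.add_apply]
  grind

theorem derivVanish_hyperbolic : DerivVanish 3 hyperbolic :=
  DerivVanish.coord_mul_coord 0 1

theorem stronglyBent_hyperbolic : StronglyBent hyperbolic := by
  intro a ha
  have h : ∀ a0 a1 : ZMod 2, (a0 ≠ 0 ∨ a1 ≠ 0) → ∃ c0 c1, a0 * c1 + a1 * c0 = 1 := by decide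
  obtain ⟨c0, c1, hc⟩ := h (a 0) (a 1) (by
    by_contra! hz
    exact ha (funext fun i => by fin_cases i <;> simp [hz]))
  refine ⟨![c0, c1], funext fun x => ?_⟩
  rw [deriv_deriv_hyperbolic]
  simpa using hc

/-- The cubic function `x₀x₁x₂ + x₀x₃ + x₁x₄ + x₂x₅`. -/
def cubicSix : BoolFun 6 := fun x => x 0 * (x 1 * x 2) + x 0 * x 3 + x 1 * x 4 + x 2 * x 5

theorem derivVanish_cubicSix : DerivVanish 4 cubicSix :=
  (((DerivVanish.coord_mul_coord_mul_coord 0 1 2).add (DerivVanish.coord_mul_coord 0 3).succ).add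
    (DerivVanish.coord_mul_coord 1 4).succ).add (DerivVanish.coord_mul_coord 2 5).succ

theorem exists_dot_eq_one : ∀ a b c : ZMod 2, (a ≠ 0 ∨ b ≠ 0 ∨ c ≠ 0) →
    ∃ u v w, a * u + b * v + c * w = 1 := by
  decide

theorem vecSix_apply (a b c d e f : ZMod 2) :
    ![a, b, c, d, e, f] 0 = a ∧ ![a, b, c, d, e, f] 1 = b ∧ ![a, b, c, d, e, f] 2 = c ∧
      ![a, b, c, d, e, f] 3 = d ∧ ![a, b, c, d, e, f] 4 = e ∧ ![a, b, c, d, e, f] 5 = f :=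
  ⟨rfl, rfl, rfl, rfl, rfl, rfl⟩

theorem stronglyBent_cubicSix : StronglyBent cubicSix := by
  intro a ha
  by_cases hv : a 0 ≠ 0 ∨ a 1 ≠ 0 ∨ a 2 ≠ 0
  · obtain ⟨u, v, w, h⟩ := exists_dot_eq_one _ _ _ hv
    refine ⟨![0, 0, 0, u, v, w], funext fun x => ?_⟩
    have hc := vecSix_apply 0 0 0 u v w
    generalize ![0, 0, 0, u, v, w] = c at hc
    simp only [deriv, cubicSix, Pi.add_apply, hc, Pi.one_apply]
    clear hc hv ha
    grind
  · push Not at hv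
    obtain ⟨u, v, w, h⟩ := exists_dot_eq_one (a 3) (a 4) (a 5) (by
      by_contra! hz
      exact ha (funext fun i => by fin_cases i <;> simp [hz, hv]))
    refine ⟨![u, v, w, 0, 0, 0], funext fun x => ?_⟩
    have hc := vecSix_apply u v w 0 0 0
    generalize ![u, v, w, 0, 0, 0] = c at hc
    simp only [deriv, cubicSix, Pi.add_apply, hc, hv, Pi.one_apply]
    clear hc hv ha
    grind

/-- The Maiorana–McFarland function `⟨u, π v⟩` for a quadratic permutation `π` of `𝔽₂³`
all of whose component functions are quadratic; `v = (x₀, x₁, x₂)`, `u = (x₃, x₄, x₅)`. -/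
def permSix : BoolFun 6 := fun x =>
  (x 3 * x 0 + x 3 * (x 1 * x 2)) + (x 4 * x 1 + x 4 * (x 0 * x 1) + x 4 * (x 0 * x 2))
    + (x 5 * x 2 + x 5 * (x 0 * x 1) + x 5 * (x 1 * x 2))

theorem derivVanish_permSix : DerivVanish 4 permSix :=
  (((DerivVanish.coord_mul_coord 3 0).succ.add (DerivVanish.coord_mul_coord_mul_coord 3 1 2)).add
    (((DerivVanish.coord_mul_coord 4 1).succ.add
      (DerivVanish.coord_mul_coord_mul_coord 4 0 1)).add
        (DerivVanish.coord_mul_coord_mul_coord 4 0 2))).add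
    (((DerivVanish.coord_mul_coord 5 2).succ.add
      (DerivVanish.coord_mul_coord_mul_coord 5 0 1)).add
        (DerivVanish.coord_mul_coord_mul_coord 5 1 2))

theorem stronglyBent_permSix : StronglyBent permSix := by
  intro a ha
  by_cases hv : a 0 ≠ 0 ∨ a 1 ≠ 0 ∨ a 2 ≠ 0
  · have h : ∀ a b c : ZMod 2, (a ≠ 0 ∨ b ≠ 0 ∨ c ≠ 0) → ∃ u v w,
        u * (a + b * c) + v * (b + a * b + a * c) + w * (c + a * b + b * c) = 1 ∧
        v * b + v * c + w * b = 0 ∧ u * c + v * a + w * a + w * c = 0 ∧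
        u * b + v * a + w * b = 0 := by decide
    obtain ⟨u, v, w, h1, h2, h3, h4⟩ := h _ _ _ hv
    refine ⟨![0, 0, 0, u, v, w], funext fun x => ?_⟩
    have hc := vecSix_apply 0 0 0 u v w
    generalize ![0, 0, 0, u, v, w] = c at hc
    simp only [deriv, permSix, Pi.add_apply, hc, Pi.one_apply]
    clear hc hv ha h
    grind
  · push Not at hv
    have h : ∀ a b c : ZMod 2, (a ≠ 0 ∨ b ≠ 0 ∨ c ≠ 0) → ∃ u v w,
        a * (u + v * w) + b * (v + u * v + u * w) + c * (w + u * v + v * w) = 1 ∧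
        b * v + b * w + c * v = 0 ∧ a * w + b * u + c * u + c * w = 0 ∧
        a * v + b * u + c * v = 0 := by decide
    obtain ⟨u, v, w, h1, h2, h3, h4⟩ := h (a 3) (a 4) (a 5) (by
      by_contra! hz
      exact ha (funext fun i => by fin_cases i <;> simp [hz, hv]))
    refine ⟨![u, v, w, 0, 0, 0], funext fun x => ?_⟩
    have hc := vecSix_apply u v w 0 0 0
    generalize ![u, v, w, 0, 0, 0] = c at hc
    simp only [deriv, permSix, Pi.add_apply, hc, hv, Pi.one_apply]
    clear hc hv ha h
    grind

theorem derivsNotAffine_permSix : DerivsNotAffine permSix := by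
  intro a ha h
  have h' : ∀ b c, deriv b (deriv c (deriv a permSix)) 0 = 0 := fun b c => congrFun (h c b) 0
  -- For basis directions `e_i, e_j` the third derivative is the sum of the `a_k` over all cubic
  -- monomials `x_i x_j x_k`.
  have e1 := h' ![0, 1, 0, 0, 0, 0] ![0, 0, 0, 1, 0, 0]
  have e2 := h' ![0, 0, 1, 0, 0, 0] ![0, 0, 0, 1, 0, 0]
  have e3 := h' ![0, 0, 1, 0, 0, 0] ![0, 0, 0, 0, 1, 0]
  have e4 := h' ![0, 1, 0, 0, 0, 0] ![0, 0, 1, 0, 0, 0]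
  have e5 := h' ![0, 0, 1, 0, 0, 0] ![1, 0, 0, 0, 0, 0]
  have e6 := h' ![0, 1, 0, 0, 0, 0] ![1, 0, 0, 0, 0, 0]
  simp [deriv, permSix] at e1 e2 e3 e4 e5 e6
  have h0 : a 0 = 0 := by grind
  have h1 : a 1 = 0 := by grind
  have h2 : a 2 = 0 := by grind
  have h4 : a 4 = 0 := by grind
  have h5 : a 5 = 0 := by grind
  have h3 : a 3 = 0 := by grind
  exact ha (funext fun i => by fin_cases i <;> simp [*])

/-! ### The basic function in ten variables -/

/-- The cubic function `s (x₀x₁ + x₂x₃) + x₀x₁ + x₀x₂ + x₁x₃` of `(x₀, x₁, x₂, x₃, s)`; both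
restrictions `s = 0` and `s = 1` are bent. -/
def pencil : BoolFun 5 := fun x =>
  x 4 * (x 0 * x 1) + x 4 * (x 2 * x 3) + x 0 * x 1 + x 0 * x 2 + x 1 * x 3

/-- The alternating form of `x₀x₁ + x₂x₃`. -/
def pencilForm (u v : Vec 5) : ZMod 2 := u 0 * v 1 + u 1 * v 0 + u 2 * v 3 + u 3 * v 2

theorem derivVanish_pencil : DerivVanish 4 pencil :=
  ((((DerivVanish.coord_mul_coord_mul_coord 4 0 1).add
    (DerivVanish.coord_mul_coord_mul_coord 4 2 3)).add (DerivVanish.coord_mul_coord 0 1).succ).add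
      (DerivVanish.coord_mul_coord 0 2).succ).add (DerivVanish.coord_mul_coord 1 3).succ

theorem deriv_deriv_deriv_pencil (a b c x : Vec 5) : deriv c (deriv a (deriv b pencil)) x
    = a 4 * pencilForm b c + b 4 * pencilForm a c + c 4 * pencilForm a b := by
  simp only [deriv, pencil, Pi.add_apply, pencilForm]
  grind

/-- For `a, c` with last coordinate 0 the second derivative is `s B(a, c) + B₀(a, c)`, with `B` the
form `pencilForm` and `B₀` that of the part free of `s`. As `B₀` and `B₀ + B` are nondegenerate,
`B₀(a, ·)` is neither 0 nor `B(a, ·)`, so some `c` has `B = 0` and `B₀ = 1`. -/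
theorem exists_deriv_deriv_pencil {a : Vec 5} (ha : a ≠ 0) (hs : a 4 = 0) :
    ∃ c, c 4 = 0 ∧ deriv c (deriv a pencil) = 1 := by
  have h : ∀ a0 a1 a2 a3 : ZMod 2, (a0 ≠ 0 ∨ a1 ≠ 0 ∨ a2 ≠ 0 ∨ a3 ≠ 0) → ∃ c0 c1 c2 c3,
      a0 * c1 + a1 * c0 + a2 * c3 + a3 * c2 = 0 ∧
      a0 * c1 + a1 * c0 + a0 * c2 + a2 * c0 + a1 * c3 + a3 * c1 = 1 := by decide
  obtain ⟨c0, c1, c2, c3, h1, h2⟩ := h (a 0) (a 1) (a 2) (a 3) (by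
    by_contra! hz
    exact ha (funext fun i => by fin_cases i <;> simp [hz, hs]))
  obtain ⟨c, hc0, hc1, hc2, hc3, hc4⟩ :
      ∃ c : Vec 5, c 0 = c0 ∧ c 1 = c1 ∧ c 2 = c2 ∧ c 3 = c3 ∧ c 4 = 0 :=
    ⟨![c0, c1, c2, c3, 0], rfl, rfl, rfl, rfl, rfl⟩
  refine ⟨c, hc4, funext fun x => ?_⟩
  simp only [deriv, pencil, Pi.add_apply, hs, hc0, hc1, hc2, hc3, hc4, Pi.one_apply]
  clear h ha hc0 hc1 hc2 hc3 hc4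
  grind

theorem derivsNotAffine_pencil : DerivsNotAffine pencil := by
  intro a ha h
  have h' : ∀ b c, b 4 * pencilForm c a + c 4 * pencilForm b a + a 4 * pencilForm b c = 0 :=
    fun b c => by
      have := congrFun (h b c) 0
      rw [deriv_comm b a] at this
      have h3 := deriv_deriv_deriv_pencil a b c 0
      rw [this] at h3
      simp only [pencilForm, Pi.zero_apply] at h3 ⊢
      grind
  have e0 := h' ![0, 1, 0, 0, 0] ![0, 0, 0, 0, 1]
  have e1 := h' ![1, 0, 0, 0, 0] ![0, 0, 0, 0, 1]
  have e2 := h' ![0, 0, 0, 1, 0] ![0, 0, 0, 0, 1]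
  have e3 := h' ![0, 0, 1, 0, 0] ![0, 0, 0, 0, 1]
  have e4 := h' ![1, 0, 0, 0, 0] ![0, 1, 0, 0, 0]
  simp [pencilForm] at e0 e1 e2 e3 e4
  exact ha (funext fun i => by fin_cases i <;> simp [*])

theorem finrank_le_two_of_isotropic (U : Submodule (ZMod 2) (Vec (4 + 1)))
    (hs : ∀ a ∈ U, a 4 = 0) (hB : ∀ a ∈ U, ∀ b ∈ U, pencilForm a b = 0) :
    finrank (ZMod 2) U ≤ 2 := by
  have h1 := finrank_le_blocks U
  have h2 : sndKernel U = ⊥ := by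
    rw [eq_bot_iff]
    intro v hv
    obtain ⟨u, hu, -, rfl⟩ := mem_sndKernel hv
    refine (Submodule.mem_bot _).2 (funext fun i => ?_)
    fin_cases i
    exact hs u hu
  -- The form `pencilForm` gives the second derivatives of the bent function `x₀x₁ + x₂x₃`, so the
  -- bound for bent functions applies to isotropic spaces.
  have h3 : 2 * finrank (ZMod 2) (U.map (fstBlock 4 1)) ≤ 4 :=
    (stronglyBent_hyperbolic.directSum stronglyBent_hyperbolic).isBent.two_mul_finrank_le
    (U.map (fstBlock 4 1)) (by
      rintro _ ⟨a, ha, rfl⟩ _ ⟨b, hb, rfl⟩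
      rw [deriv_directSum, deriv_directSum]
      funext x
      simp only [directSum, deriv_deriv_hyperbolic]
      rw [Pi.zero_apply, ← hB b hb a ha, pencilForm, add_assoc _ (b 2 * a 3)]
      rfl)
  rw [h2, finrank_bot] at h1
  omega

theorem relaxedIndexLE_pencil : RelaxedIndexLE pencil 2 := by
  intro U hU
  have hT : ∀ a ∈ U, ∀ b ∈ U, ∀ c,
      a 4 * pencilForm b c + b 4 * pencilForm a c + c 4 * pencilForm a b = 0 :=
    fun a ha b hb c => by
      rw [← deriv_deriv_deriv_pencil a b c 0]
      exact congrFun (hU a ha b hb c) 0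
  by_cases hs : ∃ a ∈ U, a 4 ≠ 0
  · obtain ⟨a, ha, hs⟩ := hs
    have ha4 : a 4 = 1 := by
      revert hs; generalize a 4 = t; revert t; decide
    -- With `a 4 = 1`, testing against `c` with `c 4 = 0` gives `pencilForm (b + b₄ a) c = 0`;
    -- nondegeneracy on the first four coordinates forces `b = b₄ a`.
    have hle : U ≤ Submodule.span (ZMod 2) {a} := by
      intro b hb
      refine Submodule.mem_span_singleton.2 ⟨b 4, ?_⟩
      have e0 := hT a ha b hb ![0, 1, 0, 0, 0]
      have e1 := hT a ha b hb ![1, 0, 0, 0, 0]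
      have e2 := hT a ha b hb ![0, 0, 0, 1, 0]
      have e3 := hT a ha b hb ![0, 0, 1, 0, 0]
      simp [pencilForm, ha4] at e0 e1 e2 e3
      rw [CharTwo.add_eq_zero] at e0 e1 e2 e3
      funext i
      fin_cases i <;> simp [*]
    have h1 := Submodule.finrank_mono hle
    have h2 := finrank_span_le_card (R := ZMod 2) ({a} : Set (Vec 5))
    simp only [Set.toFinset_singleton, Finset.card_singleton] at h2
    omega
  · push Not at hs
    have hB : ∀ a ∈ U, ∀ b ∈ U, pencilForm a b = 0 := fun a ha b hb => by
      simpa [hs a ha, hs b hb] using hT a ha b hb ![0, 0, 0, 0, 1]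
    exact finrank_le_two_of_isotropic U hs hB

/-- The bent function `pencil (x, s) + pencil (y, t) + s t`. -/
def bentTen : BoolFun (5 + 5) :=
  directSum pencil pencil + fun z => fstBlock 5 5 z 4 * sndBlock 5 5 z 4

theorem derivVanish_connecting :
    DerivVanish 3 (fun z : Vec (5 + 5) => fstBlock 5 5 z 4 * sndBlock 5 5 z 4) :=
  DerivVanish.coord_mul_coord (Fin.castAdd 5 4) (Fin.natAdd 5 4)

theorem derivVanish_bentTen : DerivVanish 4 bentTen :=
  (derivVanish_pencil.directSum derivVanish_pencil).add derivVanish_connecting.succ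

theorem derivsNotAffine_bentTen : DerivsNotAffine bentTen := by
  intro a ha h
  refine derivsNotAffine_pencil.directSum derivsNotAffine_pencil a ha ?_
  have h2 := h.add (derivVanish_connecting a)
  rw [bentTen, deriv_add, add_assoc] at h2
  rwa [show ∀ q : BoolFun (5 + 5), q + q = 0 from fun q => funext fun x => add_self_eq_zero _,
    add_zero] at h2

theorem relaxedIndexLE_bentTen : RelaxedIndexLE bentTen 4 :=
  (relaxedIndexLE_pencil.directSum relaxedIndexLE_pencil).add_quadratic derivVanish_connecting

theorem deriv_deriv_bentTen (a : Vec (5 + 5)) (c d : Vec 5) (z : Vec (5 + 5)) :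
    deriv (Fin.append c d) (deriv a bentTen) z
      = deriv c (deriv (fstBlock 5 5 a) pencil) (fstBlock 5 5 z)
        + deriv d (deriv (sndBlock 5 5 a) pencil) (sndBlock 5 5 z)
        + (fstBlock 5 5 a 4 * d 4 + c 4 * sndBlock 5 5 a 4) := by
  rw [bentTen, deriv_add, deriv_add, deriv_directSum, deriv_directSum, fstBlock_append,
    sndBlock_append, Pi.add_apply]
  congr 1
  simp only [deriv, map_add, fstBlock_append, sndBlock_append, Pi.add_apply]
  grind

theorem deriv_deriv_self {n : ℕ} (a : Vec n) (f : BoolFun n) : deriv a (deriv a f) = 0 := by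
  funext x
  have h : x + a + a = x := by
    rw [add_assoc, show a + a = 0 from funext fun i => add_self_eq_zero _, add_zero]
  simp only [deriv, h, Pi.zero_apply]
  rw [add_comm (f x), add_self_eq_zero]

theorem stronglyBent_bentTen : StronglyBent bentTen := by
  intro a ha
  have hbit : ∀ t : ZMod 2, t ≠ 0 → t = 1 := by decide
  by_cases h1 : fstBlock 5 5 a 4 = 0
  · by_cases h2 : fstBlock 5 5 a = 0
    · have h3 : sndBlock 5 5 a ≠ 0 := (blocks_ne_zero ha).resolve_left (not_not.2 h2)
      by_cases h4 : sndBlock 5 5 a 4 = 0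
      · obtain ⟨d, hd, hd1⟩ := exists_deriv_deriv_pencil h3 h4
        refine ⟨Fin.append 0 d, funext fun z => ?_⟩
        rw [deriv_deriv_bentTen, hd1, hd]
        simp
      · refine ⟨Fin.append ![0, 0, 0, 0, 1] 0, funext fun z => ?_⟩
        rw [deriv_deriv_bentTen, h2, hbit _ h4]
        simp
    · obtain ⟨c, hc, hc1⟩ := exists_deriv_deriv_pencil h2 h1
      refine ⟨Fin.append c 0, funext fun z => ?_⟩
      rw [deriv_deriv_bentTen, hc1, hc]
      simp
  · by_cases h4 : sndBlock 5 5 a 4 = 0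
    · by_cases h3 : sndBlock 5 5 a = 0
      · refine ⟨Fin.append 0 ![0, 0, 0, 0, 1], funext fun z => ?_⟩
        rw [deriv_deriv_bentTen, h3, hbit _ h1]
        simp
      · obtain ⟨d, hd, hd1⟩ := exists_deriv_deriv_pencil h3 h4
        refine ⟨Fin.append 0 d, funext fun z => ?_⟩
        rw [deriv_deriv_bentTen, hd1, hd]
        simp
    -- Repeating the first block of `a` kills both `pencil` terms, and the connecting product
    -- contributes 1.
    · refine ⟨Fin.append (fstBlock 5 5 a) 0, funext fun z => ?_⟩
      rw [deriv_deriv_bentTen, deriv_deriv_self, hbit _ h1, hbit _ h4]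
      simp

/-! ### Homogeneous forms -/

/-- The matrix over `𝔽₂` whose columns are the binary expansions of the given numbers. -/
def colMatrix {n : ℕ} (k : Fin n → ℕ) : Matrix (Fin n) (Fin n) (ZMod 2) :=
  Matrix.of fun i j => if (k j).testBit i then 1 else 0

/-- The linear automorphism given by a matrix with binary columns `k` and inverse `k'`. -/
def colEquiv {n : ℕ} (k k' : Fin n → ℕ) (h : colMatrix k' * colMatrix k = 1) :
    Vec n ≃ₗ[ZMod 2] Vec n :=
  Matrix.toLin'OfInv h (mul_eq_one_comm.1 h)

theorem colEquiv_charVec_singleton {n : ℕ} (k k' : Fin n → ℕ)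
    (h : colMatrix k' * colMatrix k = 1) (i : Fin n) :
    colEquiv k k' h (charVec {i}) = (colMatrix k).col i := by
  have : charVec {i} = Pi.single i (1 : ZMod 2) := by
    funext j; simp [charVec, Pi.single_apply]
  rw [this, ← Matrix.mulVec_single_one]
  rfl

/-- Vectors of weight 0, 1, 2 go to 0, a column, and a sum of two columns, so only a basis with
these values zero is needed. -/
theorem vanishLowWeight_comp_colEquiv {n : ℕ} (f : BoolFun n) (k k' : Fin n → ℕ)
    (h : colMatrix k' * colMatrix k = 1) (h0 : f 0 = 0)
    (h1 : ∀ i, f ((colMatrix k).col i) = 0)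
    (h2 : ∀ i j, f ((colMatrix k).col i + (colMatrix k).col j) = 0) :
    VanishLowWeight (f ∘ colEquiv k k' h) := by
  intro S hS
  have hS' : S.card = 0 ∨ S.card = 1 ∨ S.card = 2 := by omega
  rw [Function.comp_apply]
  rcases hS' with hc | hc | hc
  · rw [Finset.card_eq_zero.1 hc, show charVec (∅ : Finset (Fin n)) = 0 from
      funext fun i => by simp [charVec], map_zero, h0]
  · obtain ⟨i, rfl⟩ := Finset.card_eq_one.1 hc
    rw [colEquiv_charVec_singleton, h1]
  · obtain ⟨i, j, hij, rfl⟩ := Finset.card_eq_two.1 hc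
    rw [charVec_insert (by simpa using hij), map_add, colEquiv_charVec_singleton,
      colEquiv_charVec_singleton, h2]

theorem exists_homogeneous_cubicSix :
    ∃ A : Vec 6 ≃ₗ[ZMod 2] Vec 6, VanishLowWeight (cubicSix ∘ A) :=
  ⟨_, vanishLowWeight_comp_colEquiv cubicSix ![1, 2, 4, 14, 21, 35] ![1, 2, 4, 14, 21, 35]
    (by decide +kernel) (by decide +kernel) (by decide +kernel) (by decide +kernel)⟩

theorem exists_homogeneous_bentTen :
    ∃ A : Vec (5 + 5) ≃ₗ[ZMod 2] Vec (5 + 5), VanishLowWeight (bentTen ∘ A) :=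
  -- The first list encodes the new basis, the second the inverse matrix; bit `i` of entry `j` is
  -- the matrix entry `(i, j)`.
  ⟨_, vanishLowWeight_comp_colEquiv bentTen ![130, 260, 587, 44, 209, 144, 73, 274, 552, 901]
    ![583, 495, 163, 112, 462, 219, 631, 494, 161, 427]
    (by decide +kernel) (by decide +kernel) (by decide +kernel) (by decide +kernel)⟩

theorem exists_homogeneous_permSix_directSum :
    ∃ A : Vec (6 + 6) ≃ₗ[ZMod 2] Vec (6 + 6), VanishLowWeight (directSum permSix permSix ∘ A) :=
  ⟨_, vanishLowWeight_comp_colEquiv (directSum permSix permSix)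
    ![2, 273, 1091, 128, 2051, 2052, 64, 288, 1, 298, 2692, 224]
    ![256, 1, 305, 641, 2506, 2120, 64, 8, 2248, 1064, 325, 273]
    (by decide +kernel) (by decide +kernel) (by decide +kernel) (by decide +kernel)⟩

/-! ### Assembling the examples -/

/-- Direct sums realize all dimensions generated by two given ones. -/
theorem exists_of_directSum_closed {P : ∀ n, BoolFun n → Prop} (h0 : P 0 0)
    (hadd : ∀ {m n : ℕ} {f : BoolFun m} {g : BoolFun n}, P m f → P n g → P (m + n) (directSum f g))
    {p q : ℕ} {f : BoolFun p} {g : BoolFun q} (hf : P p f) (hg : P q g) (a b : ℕ) :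
    ∃ e : BoolFun (a * p + b * q), P _ e := by
  have hmul : ∀ {r : ℕ} {e : BoolFun r}, P r e → ∀ c : ℕ, ∃ e : BoolFun (c * r), P _ e := by
    intro r e he c
    induction c with
    | zero => rw [zero_mul]; exact ⟨0, h0⟩
    | succ c ih =>
      obtain ⟨e', he'⟩ := ih
      rw [Nat.succ_mul]
      exact ⟨directSum e' e, hadd he' he⟩
  obtain ⟨e, he⟩ := hmul hf a
  obtain ⟨e', he'⟩ := hmul hg b
  exact ⟨_, hadd he he'⟩

theorem stronglyBent_zero : StronglyBent (0 : BoolFun 0) :=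
  fun _ ha => absurd (Subsingleton.elim _ _) ha

theorem derivsNotAffine_zero : DerivsNotAffine (0 : BoolFun 0) :=
  fun _ ha => absurd (Subsingleton.elim _ _) ha

theorem not_derivVanish_of_derivsNotAffine {n : ℕ} [NeZero n] {f : BoolFun n}
    (hf : DerivsNotAffine f) : ¬ DerivVanish 3 f := fun h =>
  hf (fun _ => 1) (fun h0 => one_ne_zero (congrFun h0 0)) (h _)

/-- Adding a bent function of degree at most three in new variables to a function equivalent to
`bentTen`. -/
theorem bentTen_comp_directSum {m : ℕ} (A : Vec (5 + 5) ≃ₗ[ZMod 2] Vec (5 + 5)) {g : BoolFun m}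
    (hg : StronglyBent g) (hg4 : DerivVanish 4 g) :
    IsCubic (directSum (bentTen ∘ A) g) ∧ IsBent (directSum (bentTen ∘ A) g) ∧
      directSum (bentTen ∘ A) g ∉ completedMM (5 + 5 + m) ∧
      DerivVanish 4 (directSum (bentTen ∘ A) g) := by
  have h4 := (derivVanish_bentTen.comp A).directSum hg4
  refine ⟨isCubic_of_derivVanish h4 fun h => ?_,
    ((stronglyBent_bentTen.comp A).directSum hg).isBent,
    directSum_notMem_completedMM (relaxedIndexLE_bentTen.comp A) (by norm_num) hg.isBent, h4⟩
  exact not_derivVanish_of_derivsNotAffine (derivsNotAffine_bentTen.comp A) h.directSum_left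

theorem exists_quadratic_bent (k : ℕ) :
    ∃ g : BoolFun (2 * k), StronglyBent g ∧ DerivVanish 4 g := by
  have h := exists_of_directSum_closed (P := fun _ g => StronglyBent g ∧ DerivVanish 4 g)
    ⟨stronglyBent_zero, DerivVanish.zero 4⟩
    (fun hf hg => ⟨hf.1.directSum hg.1, hf.2.directSum hg.2⟩)
    ⟨stronglyBent_hyperbolic, derivVanish_hyperbolic.succ⟩
    ⟨stronglyBent_hyperbolic, derivVanish_hyperbolic.succ⟩ k 0
  rwa [zero_mul, add_zero, mul_comm] at h

theorem exists_bent_derivsNotAffine (a b : ℕ) :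
    ∃ g : BoolFun (a * 6 + b * 10), StronglyBent g ∧ DerivVanish 4 g ∧ DerivsNotAffine g :=
  exists_of_directSum_closed
    (P := fun _ g => StronglyBent g ∧ DerivVanish 4 g ∧ DerivsNotAffine g)
    ⟨stronglyBent_zero, DerivVanish.zero 4, derivsNotAffine_zero⟩
    (fun hf hg => ⟨hf.1.directSum hg.1, hf.2.1.directSum hg.2.1, hf.2.2.directSum hg.2.2⟩)
    ⟨stronglyBent_permSix, derivVanish_permSix, derivsNotAffine_permSix⟩
    ⟨stronglyBent_bentTen, derivVanish_bentTen, derivsNotAffine_bentTen⟩ a b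

theorem exists_bent_homogeneous (a b : ℕ) :
    ∃ g : BoolFun (a * 6 + b * 10), StronglyBent g ∧ DerivVanish 4 g ∧ VanishLowWeight g := by
  obtain ⟨A, hA⟩ := exists_homogeneous_cubicSix
  obtain ⟨B, hB⟩ := exists_homogeneous_bentTen
  exact exists_of_directSum_closed
    (P := fun _ g => StronglyBent g ∧ DerivVanish 4 g ∧ VanishLowWeight g)
    ⟨stronglyBent_zero, DerivVanish.zero 4, fun _ _ => rfl⟩
    (fun hf hg => ⟨hf.1.directSum hg.1, hf.2.1.directSum hg.2.1, hf.2.2.directSum hg.2.2⟩)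
    ⟨stronglyBent_cubicSix.comp A, derivVanish_cubicSix.comp A, hA⟩
    ⟨stronglyBent_bentTen.comp B, derivVanish_bentTen.comp B, hB⟩ a b

theorem exists_bent_homogeneous_derivsNotAffine (a b : ℕ) :
    ∃ g : BoolFun (a * 10 + b * 12),
      StronglyBent g ∧ DerivVanish 4 g ∧ VanishLowWeight g ∧ DerivsNotAffine g := by
  obtain ⟨A, hA⟩ := exists_homogeneous_bentTen
  obtain ⟨B, hB⟩ := exists_homogeneous_permSix_directSum
  exact exists_of_directSum_closed
    (P := fun _ g => StronglyBent g ∧ DerivVanish 4 g ∧ VanishLowWeight g ∧ DerivsNotAffine g)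
    ⟨stronglyBent_zero, DerivVanish.zero 4, fun _ _ => rfl, derivsNotAffine_zero⟩
    (fun hf hg => ⟨hf.1.directSum hg.1, hf.2.1.directSum hg.2.1,
      hf.2.2.1.directSum hg.2.2.1, hf.2.2.2.directSum hg.2.2.2⟩)
    ⟨stronglyBent_bentTen.comp A, derivVanish_bentTen.comp A, hA,
      derivsNotAffine_bentTen.comp A⟩
    ⟨(stronglyBent_permSix.directSum stronglyBent_permSix).comp B,
      (derivVanish_permSix.directSum derivVanish_permSix).comp B, hB,
      (derivsNotAffine_permSix.directSum derivsNotAffine_permSix).comp B⟩ a b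

/-- With `n = 2k` this asks for `k - 5 = 3a + 5b`; 7 is the largest number not of this form, so `k ≥
13` suffices. -/
theorem exists_eq_ten_add_six_mul_add_ten_mul {n : ℕ} (hn : Even n) (h : 26 ≤ n) :
    ∃ a b, n = 5 + 5 + (a * 6 + b * 10) := by
  obtain ⟨k, rfl⟩ := hn
  have h3 : k % 3 = 0 ∨ k % 3 = 1 ∨ k % 3 = 2 := by omega
  rcases h3 with h3 | h3 | h3
  · exact ⟨(k - 15) / 3, 2, by omega⟩
  · exact ⟨(k - 10) / 3, 1, by omega⟩
  · exact ⟨(k - 5) / 3, 0, by omega⟩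

theorem exists_eq_ten_add_ten_mul_add_twelve_mul {n : ℕ} (hn : Even n) (h : 50 ≤ n) :
    ∃ a b, n = 5 + 5 + (a * 10 + b * 12) := by
  obtain ⟨k, rfl⟩ := hn
  -- Here `k - 5 = 5a + 6b`, so `b` is `k` modulo 5. The subtraction never truncates: `k ≥ 25`, and
  -- residue 4 forces `k ≥ 29`.
  exact ⟨(k - 5 - 6 * (k % 5)) / 5, k % 5, by omega⟩

end CubicBent

theorem mainTheorem1 :
    (∀ n : ℕ, Even n → 10 ≤ n →
      ∃ f : CubicBent.BoolFun n,
        CubicBent.IsCubic f ∧ CubicBent.IsBent f ∧ f ∉ CubicBent.completedMM n) ∧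
    (∀ n : ℕ, Even n → 26 ≤ n →
      ∃ f : CubicBent.BoolFun n,
        CubicBent.IsCubic f ∧ CubicBent.IsBent f ∧ CubicBent.HasNoAffineDerivatives f ∧
          f ∉ CubicBent.completedMM n) ∧
    (∀ n : ℕ, Even n → 26 ≤ n →
      ∃ f : CubicBent.BoolFun n,
        CubicBent.IsCubic f ∧ CubicBent.IsBent f ∧ CubicBent.IsHomogeneous 3 f ∧
          f ∉ CubicBent.completedMM n) ∧
    (∀ n : ℕ, Even n → 50 ≤ n →
      ∃ f : CubicBent.BoolFun n,
        CubicBent.IsCubic f ∧ CubicBent.IsBent f ∧ CubicBent.IsHomogeneous 3 f ∧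
          CubicBent.HasNoAffineDerivatives f ∧ f ∉ CubicBent.completedMM n) := by
  open CubicBent in
  refine ⟨fun n hn h => ?_, fun n hn h => ?_, fun n hn h => ?_, fun n hn h => ?_⟩
  · obtain ⟨k, rfl⟩ : ∃ k, n = 5 + 5 + 2 * k := by
      obtain ⟨k, rfl⟩ := hn
      exact ⟨k - 5, by omega⟩
    obtain ⟨g, hg, hg4⟩ := exists_quadratic_bent k
    obtain ⟨h1, h2, h3, -⟩ := bentTen_comp_directSum (LinearEquiv.refl _ _) hg hg4
    exact ⟨_, h1, h2, h3⟩
  · obtain ⟨a, b, rfl⟩ := exists_eq_ten_add_six_mul_add_ten_mul hn h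
    obtain ⟨g, hg, hg4, hga⟩ := exists_bent_derivsNotAffine a b
    obtain ⟨h1, h2, h3, h4⟩ := bentTen_comp_directSum (LinearEquiv.refl _ _) hg hg4
    exact ⟨_, h1, h2, hasNoAffineDerivatives_of_derivVanish h4
      ((derivsNotAffine_bentTen.comp _).directSum hga), h3⟩
  · obtain ⟨a, b, rfl⟩ := exists_eq_ten_add_six_mul_add_ten_mul hn h
    obtain ⟨A, hA⟩ := exists_homogeneous_bentTen
    obtain ⟨g, hg, hg4, hgh⟩ := exists_bent_homogeneous a b
    obtain ⟨h1, h2, h3, h4⟩ := bentTen_comp_directSum A hg hg4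
    exact ⟨_, h1, h2, isHomogeneous_of_vanishLowWeight h4 (hA.directSum hgh), h3⟩
  · obtain ⟨a, b, rfl⟩ := exists_eq_ten_add_ten_mul_add_twelve_mul hn h
    obtain ⟨A, hA⟩ := exists_homogeneous_bentTen
    obtain ⟨g, hg, hg4, hgh, hga⟩ := exists_bent_homogeneous_derivsNotAffine a b
    obtain ⟨h1, h2, h3, h4⟩ := bentTen_comp_directSum A hg hg4
    exact ⟨_, h1, h2, isHomogeneous_of_vanishLowWeight h4 (hA.directSum hgh),
      hasNoAffineDerivatives_of_derivVanish h4
        ((derivsNotAffine_bentTen.comp A).directSum hga), h3⟩
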